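/- Graphs are simple and undirected, with a nonempty vertex set when connected. A graph is \emph{rigid} if its only automorphism is the identity. For a subgroup $G$ of a group $A$, the \emph{normaliser tower} of $G$ in $A$ is defined by $N_0(G)=G$, $N_{\beta+1}(G)=N_A(N_\beta(G))$, and $N_\lambda(G)=\bigcup_{\beta<\lambda}N_\beta(G)$ for limit ordinals $\lambda$. It \emph{terminates in exactly $\alpha$ steps} if $\alpha$ is the least ordinal such that $N_\beta(G)=N_\alpha(G)$ for all $\beta>\alpha$; the group $N_\alpha(G)$ is then called the \emph{terminal group} of the tower. (Every normaliser tower terminates.) For pairs $(H_i,\Gamma_i)$, where $\Gamma_i$ is a graph and $H_i\leqslant\operatorname{Aut}(\Gamma_i)$, let $\prod_{i\in I}(H_i,\Gamma_i)=\left(\prod_{i\in I}H_i,\ \bigoplus_{i\in I}\Gamma_i\right)$, where $\bigoplus_{i\in I}\Gamma_i$ is the disjoint union of the graphs and the full direct product $\prod_{i\in I} H_i$ acts on it componentwise. Let $\Gamma$ be a rigid connected graph. Define pairs $(H_\alpha(\Gamma),\mathcal{G}_\alpha(\Gamma))$ and $(F_\alpha(\Gamma),\mathcal{G}_\alpha(\Gamma))$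 by recursion on the ordinal $\alpha$ as follows. First, $(H_0(\Gamma),\mathcal{G}_0(\Gamma))=(F_0(\Gamma),\mathcal{G}_0(\Gamma))=(\operatorname{Aut}(\Gamma),\Gamma)=(1,\Gamma)$. For $\alpha>0$, \[ (H_\alpha(\Gamma),\mathcal{G}_\alpha(\Gamma))=(F_0(\Gamma),\mathcal{G}_0(\Gamma))\times\prod_{\beta<\alpha}(F_\beta(\Gamma),\mathcal{G}_\beta(\Gamma)), \] and $F_\alpha(\Gamma)\leqslant\operatorname{Aut}(\mathcal{G}_\alpha(\Gamma))$ is the terminal group of the normaliser tower of $H_\alpha(\Gamma)$ in $\operatorname{Aut}(\mathcal{G}_\alpha(\Gamma))$. \textbf{Lemma.} If $\Gamma$ is a rigid connected graph, then for every ordinal $\alpha$ the normaliser tower of $H_\alpha(\Gamma)$ in $\operatorname{Aut}(\mathcal{G}_\alpha(\Gamma))$ terminates in exactly $\alpha$ steps. -/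

import Mathlib

universe u

noncomputable section

namespace NormaliserTower

section Tower

variable {A : Type u} [Group A]

/-- The normaliser tower of the subgroup `G` in the ambient group `A`:
`N 0 = G`, `N (β + 1)` is the normaliser of `N β` in `A`, and at a limit ordinal `l` the group
`N l` is the union of the earlier ones (see `coe_tower_limit`). -/
def tower (G : Subgroup A) (α : Ordinal.{u}) : Subgroup A :=
  Ordinal.limitRecOn (motive := fun _ => Subgroup A) α G
    (fun _ N => Subgroup.normalizer (N : Set A))
    (fun l _ N => ⨆ β : Set.Iio l, N β.1 β.2)

theorem tower_zero (G : Subgroup A) : tower G 0 = G := by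
  simp [tower]

theorem tower_add_one (G : Subgroup A) (β : Ordinal.{u}) :
    tower G (β + 1) = Subgroup.normalizer (tower G β : Set A) := by
  simp only [tower, Ordinal.limitRecOn_add_one]

theorem tower_limit (G : Subgroup A) {l : Ordinal.{u}} (hl : Order.IsSuccLimit l) :
    tower G l = ⨆ β : Set.Iio l, tower G β.1 := by
  simp only [tower, Ordinal.limitRecOn_limit _ _ _ _ hl]

theorem tower_mono (G : Subgroup A) : Monotone (tower G) := by
  intro β γ h
  induction γ using Ordinal.limitRecOn with
  | zero => rw [nonpos_iff_eq_zero.mp h]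
  | add_one γ ih =>
    rcases h.lt_or_eq with h | rfl
    · rw [tower_add_one]
      exact (ih (Order.lt_add_one_iff.mp h)).trans Subgroup.le_normalizer
    · exact le_rfl
  | limit l hl _ =>
    rcases h.lt_or_eq with h | rfl
    · rw [tower_limit G hl]
      exact le_iSup (fun β : Set.Iio l => tower G β.1) ⟨β, h⟩
    · exact le_rfl

/-- At a limit ordinal the tower is the set-theoretic union of the earlier groups. -/
theorem coe_tower_limit (G : Subgroup A) {l : Ordinal.{u}} (hl : Order.IsSuccLimit l) :
    (tower G l : Set A) = ⋃ β : Set.Iio l, (tower G β.1 : Set A) := by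
  have : Nonempty (Set.Iio l) := ⟨⟨0, hl.bot_lt⟩⟩
  rw [tower_limit G hl, Subgroup.coe_iSup_of_directed]
  exact Monotone.directed_le fun β γ h => tower_mono G h

/-- The tower is constant from stage `α` on. -/
def StableFrom (G : Subgroup A) (α : Ordinal.{u}) : Prop :=
  ∀ β, α < β → tower G β = tower G α

/-- The tower terminates in exactly `α` steps: `α` is the least ordinal such that
`N β = N α` for all `β > α`. -/
def TerminatesInExactly (G : Subgroup A) (α : Ordinal.{u}) : Prop :=
  IsLeast {β | StableFrom G β} α

theorem exists_stableFrom (G : Subgroup A) : ∃ α, StableFrom G α := by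
  by_contra! h
  have hs : StrictMono (tower G) := by
    intro β γ hβγ
    refine (tower_mono G hβγ.le).lt_of_ne fun he => h β fun δ _ => ?_
    have h1 : tower G (β + 1) = tower G β :=
      le_antisymm ((tower_mono G (Order.add_one_le_of_lt hβγ)).trans he.ge)
        (tower_mono G (le_self_add))
    rw [tower_add_one] at h1
    have key : ∀ ε, β ≤ ε → tower G ε = tower G β := by
      intro ε
      induction ε using Ordinal.limitRecOn with
      | zero => intro h0; rw [nonpos_iff_eq_zero.mp h0]
      | add_one ε ih =>
        intro h2
        rcases h2.lt_or_eq with h2 | rfl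
        · rw [tower_add_one, ih (Order.lt_add_one_iff.mp h2), h1]
        · rfl
      | limit l hl ih =>
        intro h2
        refine le_antisymm ?_ (tower_mono G h2)
        rw [tower_limit G hl]
        refine iSup_le fun ε => ?_
        rcases le_total β ε.1 with h3 | h3
        · exact (ih ε.1 ε.2 h3).le
        · exact tower_mono G h3
    exact key δ (by order)
  exact not_injective_of_ordinal _ hs.injective

/-- The height of the tower: the least stage from which it is constant
(one exists by `exists_stableFrom`). -/
def height (G : Subgroup A) : Ordinal.{u} := sInf {α | StableFrom G α}

/-- The terminal group of the tower. -/
def terminal (G : Subgroup A) : Subgroup A := tower G (height G)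

theorem terminatesInExactly_height (G : Subgroup A) : TerminatesInExactly G (height G) :=
  ⟨csInf_mem (exists_stableFrom G), fun _ h => csInf_le' h⟩

theorem terminal_top : terminal (⊤ : Subgroup A) = ⊤ := by
  have h := tower_mono (⊤ : Subgroup A) (zero_le (a := height (⊤ : Subgroup A)))
  rw [tower_zero] at h
  exact top_le_iff.mp h

end Tower

section Graphs

/-- The automorphism group of a graph, under composition. -/
abbrev Aut {V : Type u} (Γ : SimpleGraph V) : Type u := Γ ≃g Γ

/-- A graph is rigid if its only automorphism is the identity. -/
def IsRigid {V : Type u} (Γ : SimpleGraph V) : Prop := ∀ φ : Aut Γ, φ = 1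

/-- The direct sum (disjoint union) of a family of graphs. -/
def directSum {ι : Type u} {V : ι → Type u} (Γ : ∀ i, SimpleGraph (V i)) :
    SimpleGraph (Σ i, V i) where
  Adj x y := ∃ (i : ι) (a b : V i), (Γ i).Adj a b ∧ x = ⟨i, a⟩ ∧ y = ⟨i, b⟩
  symm := by
    constructor
    rintro _ _ ⟨i, a, b, h, rfl, rfl⟩
    exact ⟨i, b, a, h.symm, rfl, rfl⟩
  loopless := by
    constructor
    rintro _ ⟨i, a, b, h, rfl, h'⟩
    cases h'
    exact (Γ i).irrefl h

theorem directSum_adj_mk {ι : Type u} {V : ι → Type u} (Γ : ∀ i, SimpleGraph (V i))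
    {i : ι} {a b : V i} : (directSum Γ).Adj ⟨i, a⟩ ⟨i, b⟩ ↔ (Γ i).Adj a b := by
  constructor
  · rintro ⟨j, c, d, h, hc, hd⟩
    cases hc
    cases hd
    exact h
  · exact fun h => ⟨i, a, b, h, rfl, rfl⟩

theorem directSum_adj_fst {ι : Type u} {V : ι → Type u} (Γ : ∀ i, SimpleGraph (V i))
    {x y : Σ i, V i} (h : (directSum Γ).Adj x y) : x.1 = y.1 := by
  obtain ⟨i, a, b, -, rfl, rfl⟩ := h
  rfl

/-- The componentwise action of a family of automorphisms on the direct sum. -/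
def sumAut {ι : Type u} {V : ι → Type u} (Γ : ∀ i, SimpleGraph (V i)) :
    (∀ i, Aut (Γ i)) →* Aut (directSum Γ) where
  toFun f :=
    { Equiv.sigmaCongrRight fun i => (f i).toEquiv with
      map_rel_iff' := by
        rintro ⟨i, a⟩ ⟨j, b⟩
        constructor
        · intro h
          obtain rfl : i = j := directSum_adj_fst Γ h
          exact (directSum_adj_mk Γ).2 ((f i).map_rel_iff.1 ((directSum_adj_mk Γ).1 h))
        · intro h
          obtain rfl : i = j := directSum_adj_fst Γ h
          exact (directSum_adj_mk Γ).2 ((f i).map_rel_iff.2 ((directSum_adj_mk Γ).1 h)) }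
  map_one' := rfl
  map_mul' _ _ := rfl

theorem sumAut_apply {ι : Type u} {V : ι → Type u} (Γ : ∀ i, SimpleGraph (V i))
    (f : ∀ i, Aut (Γ i)) (i : ι) (a : V i) : sumAut Γ f ⟨i, a⟩ = ⟨i, f i a⟩ := rfl

/-- A pair `(H, Γ)`, where `Γ` is a graph and `H` is a subgroup of `Aut Γ`. -/
structure PermGraph : Type (u + 1) where
  Vert : Type u
  graph : SimpleGraph Vert
  group : Subgroup (Aut graph)

/-- The direct product: `∏ i, H i` acting componentwise on the direct sum of the graphs. -/
def PermGraph.prod {ι : Type u} (P : ι → PermGraph.{u}) : PermGraph.{u} where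
  Vert := Σ i, (P i).Vert
  graph := directSum fun i => (P i).graph
  group := (Subgroup.pi Set.univ fun i => (P i).group).map (sumAut fun i => (P i).graph)

/-- The same graph with the terminal group of the normaliser tower of `H` in `Aut Γ`. -/
def PermGraph.terminal (P : PermGraph.{u}) : PermGraph.{u} where
  Vert := P.Vert
  graph := P.graph
  group := NormaliserTower.terminal P.group

/-- The pair `(Aut Γ, Γ)`. -/
def PermGraph.full {V : Type u} (Γ : SimpleGraph V) : PermGraph.{u} where
  Vert := V
  graph := Γ
  group := ⊤

open Classical in
/-- The pairs `(H_α(Γ), 𝒢_α(Γ))`, by recursion on `α`. The pair `(F_β(Γ), 𝒢_β(Γ))` is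
`(stageH Γ β).terminal`. For `α > 0` the product `(F_0, 𝒢_0) × ∏_{β < α} (F_β, 𝒢_β)` is taken
as one product over `α` with an extra index `none` adjoined for the additional factor
`(F_0, 𝒢_0) = (Aut Γ, Γ)`; see `stageH_zero`, `stageF_zero` and `stageH_of_ne_zero` for
the defining clauses. -/
def stageH {V : Type u} (Γ : SimpleGraph V) (α : Ordinal.{u}) : PermGraph.{u} :=
  if α = 0 then PermGraph.full Γ
  else PermGraph.prod fun o : Option α.ToType =>
    match o with
    | none => PermGraph.full Γ
    | some i => (stageH Γ (i.toOrd : Ordinal.{u})).terminal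
termination_by α
decreasing_by exact i.toOrd.2

/-- The pairs `(F_α(Γ), 𝒢_α(Γ))`. -/
def stageF {V : Type u} (Γ : SimpleGraph V) (α : Ordinal.{u}) : PermGraph.{u} :=
  (stageH Γ α).terminal

theorem stageH_zero {V : Type u} (Γ : SimpleGraph V) : stageH Γ 0 = PermGraph.full Γ := by
  rw [stageH, if_pos rfl]

theorem stageF_zero {V : Type u} (Γ : SimpleGraph V) : stageF Γ 0 = PermGraph.full Γ := by
  rw [stageF, stageH_zero]
  exact congrArg (PermGraph.mk V Γ) terminal_top

theorem stageH_of_ne_zero {V : Type u} (Γ : SimpleGraph V) {α : Ordinal.{u}} (h : α ≠ 0) :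
    stageH Γ α = PermGraph.prod fun o : Option α.ToType =>
      o.elim (stageF Γ 0) fun i => stageF Γ (i.toOrd : Ordinal.{u}) := by
  rw [stageH, if_neg h]
  congr 1
  funext o
  cases o with
  | none => exact (stageF_zero Γ).symm
  | some i => rfl

end Graphs

end NormaliserTower

end

noncomputable section

namespace NormaliserTower

/-! The components of `𝒢_α` are copies of Γ labelled by the finite sets of ordinals below α. A
nonempty such set is its maximum δ together with a finite set below δ, which matches the recursion;
the empty set labels the extra copy of Γ. For each γ, agreement from γ on is an equivalence relation
on labels, and for γ < α each class at γ + 1 is the union of two classes at γ.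

Let `C.isom β` consist of the automorphisms that preserve all these relations and keep the empty
label in its class at β. `PermGraph.prod_group_eq_isom` identifies H_α with `C.isom 0`: fixing the
empty label means fixing the maximum of every label, hence every factor, and agreement between
different factors depends on the maxima alone.

The tower is then β ↦ `C.isom β` for β ≤ α, and constant afterwards. `C.isom β` is normal in `C.isom
(β + 1)` because the class of the empty label at β + 1 has only two halves, so preserving one
preserves the other. Conversely, toggling γ within one class at γ + 1 that misses the empty label
gives an element of every `C.isom β`; conjugating these toggles shows that a normalising element
preserves agreement (`agree_of_normalizes`) and moves the empty label no further than its class at β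
+ 1. Limits work because labels are finite. In particular F_α is `C.isom α`, all
agreement-preserving automorphisms, which feeds the induction on α. -/

/-- Two finite sets of ordinals agree from `γ` on. -/
def Agree (γ : Ordinal.{u}) (s t : Finset Ordinal.{u}) : Prop := ∀ x, γ ≤ x → (x ∈ s ↔ x ∈ t)

namespace Agree

variable {γ δ : Ordinal.{u}} {r s t : Finset Ordinal.{u}}

theorem refl (γ : Ordinal.{u}) (s : Finset Ordinal.{u}) : Agree γ s s := fun _ _ => Iff.rfl

theorem symm (h : Agree γ s t) : Agree γ t s := fun x hx => (h x hx).symm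

theorem trans (h : Agree γ r s) (h' : Agree γ s t) : Agree γ r t :=
  fun x hx => (h x hx).trans (h' x hx)

theorem mono (hγ : γ ≤ δ) (h : Agree γ s t) : Agree δ s t := fun x hx => h x (hγ.trans hx)

theorem eq (h : Agree 0 s t) : s = t := Finset.ext fun x => h x (zero_le)

theorem of_add_one (h : Agree (γ + 1) s t) (hγ : γ ∈ s ↔ γ ∈ t) : Agree γ s t := by
  intro x hx
  rcases hx.eq_or_lt with rfl | hx
  · exact hγ
  · exact h x (Order.add_one_le_of_lt hx)

theorem of_lt (hs : ∀ x ∈ s, x < γ) (ht : ∀ x ∈ t, x < γ) : Agree γ s t := fun x hx =>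
  ⟨fun h => absurd (hs x h) hx.not_gt, fun h => absurd (ht x h) hx.not_gt⟩

/-- Below a limit ordinal, agreement is attained at an earlier stage. -/
theorem exists_lt_of_isSuccLimit {l : Ordinal.{u}} (hl : Order.IsSuccLimit l) (h : Agree l s t) :
    ∃ γ < l, Agree γ s t := by
  classical
  -- The finitely many elements below the limit have a common strict bound that is still below it.
  obtain ⟨γ, hγ, hb⟩ : ∃ γ < l, ∀ x ∈ s ∪ t, x < l → x < γ := by
    induction s ∪ t using Finset.induction_on with
    | empty => exact ⟨0, hl.bot_lt, by simp⟩
    | insert a r _ ih =>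
      obtain ⟨γ, hγ, hb⟩ := ih
      by_cases ha : a < l
      · refine ⟨max γ (a + 1), max_lt hγ (hl.add_one_lt ha), fun x hx hxl => ?_⟩
        rcases Finset.mem_insert.1 hx with rfl | hx
        · exact lt_max_of_lt_right (Order.lt_add_one_iff.2 le_rfl)
        · exact lt_max_of_lt_left (hb x hx hxl)
      · refine ⟨γ, hγ, fun x hx hxl => ?_⟩
        rcases Finset.mem_insert.1 hx with rfl | hx
        · exact absurd hxl ha
        · exact hb x hx hxl
  refine ⟨γ, hγ, fun x hx => ?_⟩
  rcases lt_or_ge x l with hxl | hxl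
  · constructor <;> intro hm <;>
      exact absurd (hb x (by simp [hm]) hxl) hx.not_gt
  · exact h x hxl

theorem insert_iff (hs : ∀ x ∈ s, x < δ) (ht : ∀ x ∈ t, x < δ) :
    Agree γ (insert δ s) (insert δ t) ↔ Agree γ s t := by
  refine forall₂_congr fun x _ => ?_
  by_cases h : x = δ
  · subst h
    simp [show x ∉ s from fun h => (hs x h).false, show x ∉ t from fun h => (ht x h).false]
  · simp [h]

theorem insert_left_iff (hs : ∀ x ∈ s, x < δ) (ht : ∀ x ∈ t, x < δ) :
    Agree γ (insert δ s) t ↔ δ < γ := by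
  constructor
  · intro h
    by_contra hc
    exact (ht δ ((h δ (not_lt.1 hc)).1 (Finset.mem_insert_self _ _))).false
  · intro h
    refine of_lt (fun x hx => ?_) fun x hx => (ht x hx).trans h
    rcases Finset.mem_insert.1 hx with rfl | hx
    exacts [h, (hs x hx).trans h]

theorem insert_right_iff (hs : ∀ x ∈ s, x < δ) (ht : ∀ x ∈ t, x < δ) :
    Agree γ s (insert δ t) ↔ δ < γ :=
  ⟨fun h => (insert_left_iff ht hs).1 h.symm, fun h => ((insert_left_iff ht hs).2 h).symm⟩

end Agree

/-! ### Toggling one ordinal within a class -/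

open Classical in
/-- Toggle membership of `γ` in the sets which agree with `t` above `γ`. -/
def toggle (γ : Ordinal.{u}) (t s : Finset Ordinal.{u}) : Finset Ordinal.{u} :=
  if Agree (γ + 1) s t then symmDiff s {γ} else s

section toggle

variable {γ δ : Ordinal.{u}} {s s' t : Finset Ordinal.{u}}

theorem toggle_of_not_agree (h : ¬ Agree (γ + 1) s t) : toggle γ t s = s := if_neg h

theorem mem_toggle_of_ne {x : Ordinal.{u}} (h : x ≠ γ) : x ∈ toggle γ t s ↔ x ∈ s := by
  unfold toggle
  split_ifs
  · simp [Finset.mem_symmDiff, h]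
  · rfl

theorem self_mem_toggle (h : Agree (γ + 1) s t) : γ ∈ toggle γ t s ↔ γ ∉ s := by
  simp [toggle, h, Finset.mem_symmDiff]

theorem agree_toggle (hδ : γ < δ) : Agree δ (toggle γ t s) s :=
  fun _ hx => mem_toggle_of_ne (hδ.trans_le hx).ne'

theorem not_agree_toggle (h : Agree (γ + 1) s t) : ¬ Agree γ (toggle γ t s) s := fun h' =>
  iff_not_self ((h' γ le_rfl).symm.trans (self_mem_toggle h))

theorem agree_toggle_iff : Agree (γ + 1) (toggle γ t s) t ↔ Agree (γ + 1) s t :=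
  ⟨fun h => (agree_toggle (Order.lt_add_one_iff.2 le_rfl)).symm.trans h,
    fun h => (agree_toggle (Order.lt_add_one_iff.2 le_rfl)).trans h⟩

theorem toggle_toggle : toggle γ t (toggle γ t s) = s := by
  by_cases h : Agree (γ + 1) s t
  · ext x
    by_cases hx : x = γ
    · subst hx
      rw [self_mem_toggle (agree_toggle_iff.2 h), self_mem_toggle h, not_not]
    · rw [mem_toggle_of_ne hx, mem_toggle_of_ne hx]
  · rw [toggle_of_not_agree (mt agree_toggle_iff.1 h), toggle_of_not_agree h]

/-- At a coordinate γ ≥ δ, the two sets already agree above γ, so both are toggled or neither is. -/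
theorem Agree.toggle (h : Agree δ s s') : Agree δ (toggle γ t s) (toggle γ t s') := by
  intro x hx
  by_cases hxγ : x = γ
  · subst hxγ
    have h1 := h.mono (hx.trans (Order.lt_add_one_iff.2 le_rfl).le)
    by_cases hs : Agree (x + 1) s t
    · rw [self_mem_toggle hs, self_mem_toggle (h1.symm.trans hs), h x hx]
    · rw [toggle_of_not_agree hs, toggle_of_not_agree fun h' => hs (h1.trans h'), h x hx]
  · rw [mem_toggle_of_ne hxγ, mem_toggle_of_ne hxγ, h x hx]

theorem lt_of_mem_toggle {α : Ordinal.{u}} (hγ : γ < α) (hs : ∀ x ∈ s, x < α) :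
    ∀ x ∈ NormaliserTower.toggle γ t s, x < α := by
  intro x hx
  by_cases hxγ : x = γ
  · exact hxγ ▸ hγ
  · exact hs x ((mem_toggle_of_ne hxγ).1 hx)

end toggle

/-! ### Charts and the groups of agreement-preserving automorphisms -/

/-- An identification of the graph `G` with the disjoint union of copies of `Γ` indexed by the
finite sets of ordinals below `α`. -/
structure Chart {V W : Type u} (Γ : SimpleGraph V) (G : SimpleGraph W) (α : Ordinal.{u}) where
  label : W → Finset Ordinal.{u}
  point : W → V
  label_lt : ∀ w, ∀ x ∈ label w, x < α
  inj : ∀ {w w'}, label w = label w' → point w = point w' → w = w'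
  surj : ∀ s : Finset Ordinal.{u}, (∀ x ∈ s, x < α) → ∀ v, ∃ w, label w = s ∧ point w = v
  adj_iff : ∀ {w w'}, G.Adj w w' ↔ label w = label w' ∧ Γ.Adj (point w) (point w')

namespace Chart

variable {V W : Type u} {Γ : SimpleGraph V} {G : SimpleGraph W} {α : Ordinal.{u}}

theorem reachable (C : Chart Γ G α) (hΓ : Γ.Connected) {v w : W} (h : C.label v = C.label w) :
    G.Reachable v w := by
  obtain ⟨p⟩ := hΓ.preconnected (C.point v) (C.point w)
  generalize hx : C.point v = x at p
  generalize hy : C.point w = y at p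
  induction p generalizing v with
  | nil => rw [C.inj h (hx.trans hy.symm)]
  | @cons a b c hab p ih =>
    obtain ⟨b', hb, rfl⟩ := C.surj (C.label v) (C.label_lt v) b
    have hv : G.Adj v b' := C.adj_iff.2 ⟨hb.symm, hx ▸ hab⟩
    exact hv.reachable.trans (ih (hb.trans h) rfl hy)

theorem label_eq_of_reachable (C : Chart Γ G α) {v w : W} (h : G.Reachable v w) :
    C.label v = C.label w := by
  obtain ⟨p⟩ := h
  induction p with
  | nil => rfl
  | cons hab _ ih => exact (C.adj_iff.1 hab).1.trans ih

/-- Labels name connected components, so an automorphism acts on labels. -/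
theorem label_apply_eq (C : Chart Γ G α) (hΓ : Γ.Connected) (φ : Aut G) {v w : W}
    (h : C.label v = C.label w) : C.label (φ v) = C.label (φ w) :=
  C.label_eq_of_reachable ((C.reachable hΓ h).map φ.toHom)

theorem exists_label_empty (C : Chart Γ G α) (hΓ : Γ.Connected) : ∃ w, C.label w = ∅ := by
  obtain ⟨v⟩ := hΓ.nonempty
  obtain ⟨w, hw, -⟩ := C.surj ∅ (by simp) v
  exact ⟨w, hw⟩

/-- The automorphisms which preserve all the agreement relations between labels and send the empty
label to a label with all elements below `β`. -/
def isom (C : Chart Γ G α) (β : Ordinal.{u}) : Subgroup (Aut G) where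
  carrier := {φ | (∀ v w γ, Agree γ (C.label v) (C.label w) ↔
      Agree γ (C.label (φ v)) (C.label (φ w))) ∧
    ∀ v, C.label v = ∅ → Agree β (C.label v) (C.label (φ v))}
  one_mem' := ⟨fun _ _ _ => Iff.rfl, fun _ _ => Agree.refl _ _⟩
  mul_mem' := by
    rintro φ ψ ⟨h1, h2⟩ ⟨h3, h4⟩
    refine ⟨fun v w γ => (h3 v w γ).trans (h1 _ _ γ), fun v hv => ?_⟩
    exact (h2 v hv).trans ((h1 _ _ β).1 (h4 v hv))
  inv_mem' := by
    rintro φ ⟨h1, h2⟩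
    have h3 : ∀ v w γ, Agree γ (C.label v) (C.label w) ↔
        Agree γ (C.label (φ⁻¹ v)) (C.label (φ⁻¹ w)) := fun v w γ => by
      rw [h1 (φ⁻¹ v) (φ⁻¹ w), RelIso.apply_inv_self, RelIso.apply_inv_self]
    refine ⟨h3, fun v hv => ?_⟩
    have h4 := (h3 _ _ β).1 (h2 v hv)
    rw [RelIso.inv_apply_self] at h4
    exact h4.symm

theorem isom_mono (C : Chart Γ G α) : Monotone C.isom :=
  fun _ _ h _ hφ => ⟨hφ.1, fun v hv => (hφ.2 v hv).mono h⟩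

/-- Permute the copies of Γ by the toggle and keep the point inside the copy. -/
theorem exists_flip (C : Chart Γ G α) {γ : Ordinal.{u}} (hγ : γ < α) (t : Finset Ordinal.{u}) :
    ∃ φ : Aut G, ∀ v, C.label (φ v) = toggle γ t (C.label v) := by
  choose f hf hf' using fun v => C.surj (toggle γ t (C.label v))
    (lt_of_mem_toggle hγ (C.label_lt v)) (C.point v)
  have hff : Function.Involutive f := fun v =>
    C.inj (by rw [hf, hf, toggle_toggle]) (by rw [hf', hf'])
  refine ⟨⟨hff.toPerm, fun {v w} => ?_⟩, hf⟩
  rw [Function.Involutive.coe_toPerm, C.adj_iff, C.adj_iff, hf, hf, hf', hf']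
  refine and_congr_left fun _ => ⟨fun h => ?_, fun h => by rw [h]⟩
  rw [← toggle_toggle (s := C.label v) (γ := γ) (t := t), h, toggle_toggle]

theorem flip_mem_isom {C : Chart Γ G α} {β γ : Ordinal.{u}} {t : Finset Ordinal.{u}} {φ : Aut G}
    (hφ : ∀ v, C.label (φ v) = toggle γ t (C.label v)) (h : Agree β (toggle γ t ∅) ∅) :
    φ ∈ C.isom β := by
  refine ⟨fun v w δ => ?_, fun v hv => ?_⟩
  · rw [hφ, hφ]
    refine ⟨fun h => h.toggle, fun h => ?_⟩
    have := h.toggle (γ := γ) (t := t)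
    rwa [toggle_toggle, toggle_toggle] at this
  · rw [hφ, hv]
    exact h.symm

theorem exists_flip_fixing_empty (C : Chart Γ G α) {γ : Ordinal.{u}} (hγ : γ < α) {y : W}
    (hy : ¬ Agree (γ + 1) ∅ (C.label y)) :
    ∃ φ : Aut G, (∀ β, φ ∈ C.isom β) ∧ ¬ Agree γ (C.label (φ y)) (C.label y) ∧
      ∀ x, ¬ Agree (γ + 1) (C.label x) (C.label y) → C.label (φ x) = C.label x := by
  obtain ⟨φ, hφ⟩ := C.exists_flip hγ (C.label y)
  refine ⟨φ, fun β => flip_mem_isom hφ ?_, ?_, fun x hx => ?_⟩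
  · rw [toggle_of_not_agree hy]
    exact Agree.refl _ _
  · rw [hφ]
    exact not_agree_toggle (Agree.refl _ _)
  · rw [hφ, toggle_of_not_agree hx]

/-! ### Normalisers -/

/-- An automorphism normalising `C.isom β` preserves the agreement relations. -/
theorem agree_of_normalizes (C : Chart Γ G α) (hΓ : Γ.Connected) {β : Ordinal.{u}} {g : Aut G}
    (hg : ∀ h ∈ C.isom β, g⁻¹ * h * g ∈ C.isom β) (γ : Ordinal.{u}) :
    ∀ v w, Agree γ (C.label v) (C.label w) → Agree γ (C.label (g v)) (C.label (g w)) := by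
  induction γ using Ordinal.limitRecOn with
  | zero =>
    intro v w h
    rw [C.label_apply_eq hΓ g h.eq]
    exact Agree.refl _ _
  | limit l hl ih =>
    intro v w h
    obtain ⟨γ, hγ, h⟩ := h.exists_lt_of_isSuccLimit hl
    exact (ih γ hγ v w h).mono hγ.le
  | add_one γ ih =>
    have key : ∀ v w, Agree (γ + 1) (C.label v) (C.label w) →
        ¬ Agree (γ + 1) ∅ (C.label (g w)) →
        Agree (γ + 1) (C.label (g v)) (C.label (g w)) := by
      intro v w h hw
      by_contra hc
      -- Labels lie below α, so from any γ ≥ α on every label agrees with the empty set.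
      have hγα : γ < α := by
        by_contra hα
        exact hw (Agree.of_lt (by simp) fun x hx => (C.label_lt _ x hx).trans_le
          ((not_lt.1 hα).trans (Order.lt_add_one_iff.2 le_rfl).le))
      -- Toggle γ in the class of `g w` at γ + 1: this fixes the label of `g v` and moves `g w` out
      -- of its class at γ.
      obtain ⟨k, hk, hmove, hfix⟩ := C.exists_flip_fixing_empty hγα hw
      have hk' := (hg k (hk β)).1
      have hv : C.label ((g⁻¹ * k * g) v) = C.label v := by
        have := C.label_apply_eq hΓ g⁻¹ (hfix (g v) hc)
        rwa [RelIso.inv_apply_self] at this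
      have hγv : ¬ (γ ∈ C.label v ↔ γ ∈ C.label w) := fun h' =>
        hc ((ih v w (h.of_add_one h')).mono (Order.lt_add_one_iff.2 le_rfl).le)
      have h1 : Agree (γ + 1) (C.label v) (C.label ((g⁻¹ * k * g) w)) :=
        hv ▸ (hk' v w (γ + 1)).1 h
      have h2 : ¬ (γ ∈ C.label v ↔ γ ∈ C.label ((g⁻¹ * k * g) w)) := fun h' =>
        hγv (((hk' v w γ).2 (hv.symm ▸ h1.of_add_one h')) γ le_rfl)
      -- `v` and `w` lie in the two different halves of one class at γ + 1. The conjugate fixes the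
      -- half of `v`, hence also that of `w`; transporting by `g` contradicts the choice of `k`.
      have h3 : Agree γ (C.label ((g⁻¹ * k * g) w)) (C.label w) :=
        (h1.symm.trans h).of_add_one (by tauto)
      have h4 := ih _ _ h3
      rw [show g ((g⁻¹ * k * g) w) = k (g w) from RelIso.apply_inv_self g _] at h4
      exact hmove h4
    intro v w h
    by_cases hw : Agree (γ + 1) ∅ (C.label (g w))
    · by_cases hv : Agree (γ + 1) ∅ (C.label (g v))
      · exact hv.symm.trans hw
      · exact (key w v h.symm hv).symm
    · exact key v w h hw

theorem mem_isom_of_mem_normalizer (C : Chart Γ G α) (hΓ : Γ.Connected) {β : Ordinal.{u}}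
    {g : Aut G} (hg : g ∈ Subgroup.normalizer (C.isom β : Set (Aut G))) : g ∈ C.isom α := by
  have h1 : ∀ h ∈ C.isom β, g⁻¹ * h * g ∈ C.isom β := fun h hh =>
    (Subgroup.mem_normalizer_iff''.1 hg h).1 hh
  have h2 : ∀ h ∈ C.isom β, g⁻¹⁻¹ * h * g⁻¹ ∈ C.isom β := fun h hh => by
    rw [inv_inv]
    exact (Subgroup.mem_normalizer_iff.1 hg h).1 hh
  refine ⟨fun v w γ => ⟨C.agree_of_normalizes hΓ h1 γ v w, fun h => ?_⟩,
    fun v _ => Agree.of_lt (C.label_lt _) (C.label_lt _)⟩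
  have h3 := C.agree_of_normalizes hΓ h2 γ _ _ h
  rwa [RelIso.inv_apply_self, RelIso.inv_apply_self] at h3

theorem normalizer_isom_self (C : Chart Γ G α) (hΓ : Γ.Connected) :
    Subgroup.normalizer (C.isom α : Set (Aut G)) = C.isom α :=
  le_antisymm (fun _ hg => C.mem_isom_of_mem_normalizer hΓ hg) Subgroup.le_normalizer

/-- `g⁻¹` sends the empty label into one of the two halves of its class at β + 1. As `h` preserves
the half of the empty label, it preserves both. -/
theorem conj_mem_isom (C : Chart Γ G α) {β : Ordinal.{u}} {g h : Aut G}
    (hg : g ∈ C.isom (β + 1)) (hh : h ∈ C.isom β) : g * h * g⁻¹ ∈ C.isom β := by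
  have hm : β ≤ β + 1 := (Order.lt_add_one_iff.2 le_rfl).le
  refine ⟨((C.isom (β + 1)).mul_mem ((C.isom (β + 1)).mul_mem hg (C.isom_mono hm hh))
    ((C.isom (β + 1)).inv_mem hg)).1, fun v hv => ?_⟩
  have h1 := ((C.isom (β + 1)).inv_mem hg).2 v hv
  have h2 : Agree β (C.label (g⁻¹ v)) (C.label (h (g⁻¹ v))) := by
    have h3 := (hh.1 v (g⁻¹ v) β)
    have h4 := hh.2 v hv
    have h5 := (hh.1 v (g⁻¹ v) (β + 1)).1 h1
    have := h4 β le_rfl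
    have h7 := h5.symm.trans ((h4.mono hm).symm.trans h1)
    refine h7.symm.of_add_one ?_
    by_cases h8 : β ∈ C.label v ↔ β ∈ C.label (g⁻¹ v)
    · have h9 := h3.1 (h1.of_add_one h8) β le_rfl
      tauto
    · have h9 : ¬ (β ∈ C.label (h v) ↔ β ∈ C.label (h (g⁻¹ v))) := fun h' =>
        h8 (h3.2 (h5.of_add_one h') β le_rfl)
      tauto
  have h3 := (hg.1 _ _ β).1 h2
  rwa [RelIso.apply_inv_self] at h3

theorem normalizer_isom (C : Chart Γ G α) (hΓ : Γ.Connected) {β : Ordinal.{u}} (hβ : β < α) :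
    Subgroup.normalizer (C.isom β : Set (Aut G)) = C.isom (β + 1) := by
  ext g
  refine ⟨fun hg => ⟨(C.mem_isom_of_mem_normalizer hΓ hg).1, fun v hv => ?_⟩, fun hg => ?_⟩
  · have hi := (C.mem_isom_of_mem_normalizer hΓ hg).1
    by_contra hc
    rw [hv] at hc
    -- If `g v` left the class of the empty label at β + 1, the toggle around `g v` would have a
    -- conjugate in `C.isom β` keeping `v` in its class at β, so the toggle could not move `g v` out
    -- of its own.
    obtain ⟨k, hk, hmove, -⟩ := C.exists_flip_fixing_empty hβ hc
    have h1 := ((Subgroup.mem_normalizer_iff''.1 hg k).1 (hk β)).2 v hv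
    have h2 := (hi _ _ β).1 h1
    rw [show g ((g⁻¹ * k * g) v) = k (g v) from RelIso.apply_inv_self g _] at h2
    exact hmove h2.symm
  · refine Subgroup.mem_normalizer_iff.2 fun h => ⟨C.conj_mem_isom hg, fun hh => ?_⟩
    have := C.conj_mem_isom ((C.isom (β + 1)).inv_mem hg) hh
    simpa [mul_assoc] using this

/-- The only condition depending on l concerns the image of the single empty label, a finite set. -/
theorem isom_limit (C : Chart Γ G α) (hΓ : Γ.Connected) {l : Ordinal.{u}}
    (hl : Order.IsSuccLimit l) : C.isom l = ⨆ β : Set.Iio l, C.isom β.1 := by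
  refine le_antisymm (fun g hg => ?_) (iSup_le fun β => C.isom_mono β.2.le)
  obtain ⟨w, hw⟩ := C.exists_label_empty hΓ
  obtain ⟨γ, hγ, h⟩ := (hg.2 w hw).exists_lt_of_isSuccLimit hl
  refine le_iSup (fun β : Set.Iio l => C.isom β.1) ⟨γ, hγ⟩ ⟨hg.1, fun v hv => ?_⟩
  rwa [C.label_apply_eq hΓ g (hv.trans hw.symm), hv, ← hw]

/-! ### The tower of `C.isom 0` -/

theorem tower_isom (C : Chart Γ G α) (hΓ : Γ.Connected) {β : Ordinal.{u}} (hβ : β ≤ α) :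
    tower (C.isom 0) β = C.isom β := by
  induction β using Ordinal.limitRecOn with
  | zero => exact tower_zero _
  | add_one β ih =>
    have h := Order.add_one_le_iff.1 hβ
    rw [tower_add_one, ih h.le, C.normalizer_isom hΓ h]
  | limit l hl ih =>
    rw [tower_limit _ hl, C.isom_limit hΓ hl]
    exact iSup_congr fun γ => ih γ.1 γ.2 (γ.2.le.trans hβ)

theorem tower_isom_of_le (C : Chart Γ G α) (hΓ : Γ.Connected) {β : Ordinal.{u}} (hβ : α ≤ β) :
    tower (C.isom 0) β = C.isom α := by
  induction β using Ordinal.limitRecOn with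
  | zero =>
    obtain rfl := nonpos_iff_eq_zero.1 hβ
    exact tower_zero _
  | add_one β ih =>
    rcases hβ.lt_or_eq with h | rfl
    · rw [tower_add_one, ih (Order.lt_add_one_iff.1 h), C.normalizer_isom_self hΓ]
    · exact C.tower_isom hΓ le_rfl
  | limit l hl ih =>
    refine le_antisymm ?_ ((C.tower_isom hΓ le_rfl).symm.le.trans (tower_mono _ hβ))
    rw [tower_limit _ hl]
    refine iSup_le fun γ => ?_
    rcases le_total α γ.1 with h | h
    · exact (ih γ.1 γ.2 h).le
    · exact (C.tower_isom hΓ h).le.trans (C.isom_mono h)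

/-- The toggle that sends the empty label to {β} separates the two groups. -/
theorem isom_lt_isom_add_one (C : Chart Γ G α) (hΓ : Γ.Connected) {β : Ordinal.{u}} (hβ : β < α) :
    C.isom β < C.isom (β + 1) := by
  refine SetLike.lt_iff_le_and_exists.2 ⟨C.isom_mono (Order.lt_add_one_iff.2 le_rfl).le, ?_⟩
  obtain ⟨φ, hφ⟩ := C.exists_flip hβ ∅
  refine ⟨φ, flip_mem_isom hφ (agree_toggle (Order.lt_add_one_iff.2 le_rfl)), fun h => ?_⟩
  obtain ⟨w, hw⟩ := C.exists_label_empty hΓ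
  have h1 := h.2 w hw
  rw [hφ, hw] at h1
  exact not_agree_toggle (Agree.refl _ _) h1.symm

theorem terminatesInExactly (C : Chart Γ G α) (hΓ : Γ.Connected) :
    TerminatesInExactly (C.isom 0) α := by
  refine ⟨fun β hβ => ?_, fun β hβ => ?_⟩
  · rw [C.tower_isom_of_le hΓ hβ.le, C.tower_isom hΓ le_rfl]
  · by_contra hc
    rw [not_le] at hc
    have h := hβ (β + 1) (Order.lt_add_one_iff.2 le_rfl)
    rw [C.tower_isom hΓ hc.le, C.tower_isom hΓ (Order.add_one_le_of_lt hc)] at h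
    exact (C.isom_lt_isom_add_one hΓ hc).ne' h

theorem terminal_isom (C : Chart Γ G α) (hΓ : Γ.Connected) :
    terminal (C.isom 0) = C.isom α := by
  rw [terminal, (terminatesInExactly_height _).unique (C.terminatesInExactly hΓ),
    C.tower_isom hΓ le_rfl]

theorem mem_isom_self {C : Chart Γ G α} {φ : Aut G} :
    φ ∈ C.isom α ↔ ∀ v w γ, Agree γ (C.label v) (C.label w) ↔
      Agree γ (C.label (φ v)) (C.label (φ w)) :=
  ⟨fun h => h.1, fun h => ⟨h, fun _ _ => Agree.of_lt (C.label_lt _) (C.label_lt _)⟩⟩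

/-- A graph as a single copy of itself. -/
def single (Γ : SimpleGraph V) : Chart Γ Γ 0 where
  label _ := ∅
  point v := v
  label_lt := by simp
  inj _ h := h
  surj s hs v := ⟨v, (Finset.eq_empty_of_forall_notMem fun x hx => not_lt_zero (hs x hx)).symm, rfl⟩
  adj_iff := by simp

theorem isom_single (Γ : SimpleGraph V) (β : Ordinal.{u}) : (single Γ).isom β = ⊤ :=
  top_le_iff.1 fun _ _ => ⟨fun _ _ _ => Iff.rfl, fun _ _ => Agree.refl _ _⟩

end Chart

/-! ### Direct sums and their charts -/

theorem exists_eq_sumAut {ι : Type u} {W : ι → Type u} {G : ∀ i, SimpleGraph (W i)}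
    (φ : Aut (directSum G)) (h : ∀ x, (φ x).1 = x.1) : ∃ f, sumAut G f = φ := by
  have h1 : ∀ (ψ : Aut (directSum G)), (∀ x, (ψ x).1 = x.1) →
      ∀ i (a : W i), ∃ b, ψ ⟨i, a⟩ = ⟨i, b⟩ := by
    intro ψ hψ i a
    have := hψ ⟨i, a⟩
    generalize ψ ⟨i, a⟩ = y at this
    obtain ⟨j, b⟩ := y
    obtain rfl : j = i := this
    exact ⟨b, rfl⟩
  have h' : ∀ x, (φ⁻¹ x).1 = x.1 := fun x => by
    rw [← h (φ⁻¹ x), RelIso.apply_inv_self]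
  choose f hf using h1 φ h
  choose g hg using h1 φ⁻¹ h'
  refine ⟨fun i => ⟨⟨f i, g i, fun a => ?_, fun a => ?_⟩, fun {a b} => ?_⟩, ?_⟩
  · have := hg i (f i a)
    rw [← hf, RelIso.inv_apply_self] at this
    exact (sigma_mk_injective this).symm
  · have := hf i (g i a)
    rw [← hg, RelIso.apply_inv_self] at this
    exact (sigma_mk_injective this).symm
  · change (G i).Adj (f i a) (f i b) ↔ _
    rw [← directSum_adj_mk G, ← hf, ← hf, φ.map_rel_iff, directSum_adj_mk]
  · ext1 ⟨i, a⟩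
    exact (hf i a).symm

theorem PermGraph.mem_prod_group {ι : Type u} {P : ι → PermGraph.{u}}
    {φ : Aut (directSum fun i => (P i).graph)} :
    φ ∈ (PermGraph.prod P).group ↔
      ∃ f : ∀ i, Aut (P i).graph, (∀ i, f i ∈ (P i).group) ∧ sumAut _ f = φ := by
  refine Subgroup.mem_map.trans (exists_congr fun f => and_congr_left fun _ => ?_)
  simp [Subgroup.mem_pi]

variable {α : Ordinal.{u}}

/-- The ordinal indexing a factor of the product over `α` with an extra index adjoined. -/
def rank (o : Option α.ToType) : Ordinal.{u} := o.elim 0 fun i => i.toOrd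

/-- Adjoin the index of a factor to a label of that factor. -/
def adjoin (o : Option α.ToType) (s : Finset Ordinal.{u}) : Finset Ordinal.{u} :=
  o.elim s fun i => insert (i.toOrd : Ordinal.{u}) s

section adjoin

variable {γ : Ordinal.{u}} {o o' : Option α.ToType} {s t : Finset Ordinal.{u}}

theorem eq_empty_of_lt_zero (hs : ∀ x ∈ s, x < 0) : s = ∅ :=
  Finset.eq_empty_of_forall_notMem fun x hx => not_lt_zero (hs x hx)

theorem adjoin_lt (hs : ∀ x ∈ s, x < rank o) : ∀ x ∈ adjoin o s, x < α := by
  intro x hx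
  cases o with
  | none => exact absurd (hs x hx) not_lt_zero
  | some i =>
    rcases Finset.mem_insert.1 hx with rfl | hx
    · exact i.toOrd.2
    · exact (hs x hx).trans i.toOrd.2

theorem agree_adjoin_iff (hs : ∀ x ∈ s, x < rank o) (ht : ∀ x ∈ t, x < rank o) :
    Agree γ (adjoin o s) (adjoin o t) ↔ Agree γ s t := by
  cases o with
  | none => rfl
  | some i => exact Agree.insert_iff hs ht

theorem toOrd_lt_of_lt {i j : α.ToType} (h : i < j) :
    (i.toOrd : Ordinal.{u}) < (j.toOrd : Ordinal.{u}) := by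
  simpa using h

/-- The larger index is the maximum of one label and exceeds everything in the other, so it alone
decides where agreement begins. -/
theorem agree_adjoin_iff_of_ne (h : o ≠ o') (hs : ∀ x ∈ s, x < rank o)
    (ht : ∀ x ∈ t, x < rank o') :
    Agree γ (adjoin o s) (adjoin o' t) ↔
      ∀ i, (o = some i ∨ o' = some i) → (i.toOrd : Ordinal.{u}) < γ := by
  cases o with
  | none =>
    cases o' with
    | none => exact absurd rfl h
    | some j =>
      obtain rfl := eq_empty_of_lt_zero hs
      exact (Agree.insert_right_iff (s := ∅) (by simp) ht).trans (by simp [rank])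
  | some i =>
    cases o' with
    | none =>
      obtain rfl := eq_empty_of_lt_zero ht
      exact (Agree.insert_left_iff (t := ∅) hs (by simp)).trans (by simp [rank])
    | some j =>
      rcases lt_trichotomy i j with hij | rfl | hij
      · have hij := toOrd_lt_of_lt hij
        refine (Agree.insert_right_iff (fun x hx => ?_) ht).trans ?_
        · rcases Finset.mem_insert.1 hx with rfl | hx
          exacts [hij, (hs x hx).trans hij]
        · simpa [or_imp, forall_and, rank] using fun h => hij.trans h
      · exact absurd rfl h
      · have hij := toOrd_lt_of_lt hij
        refine (Agree.insert_left_iff hs (fun x hx => ?_)).trans ?_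
        · rcases Finset.mem_insert.1 hx with rfl | hx
          exacts [hij, (ht x hx).trans hij]
        · simpa [or_imp, forall_and, rank] using fun h => hij.trans h

theorem eq_of_adjoin_eq (hs : ∀ x ∈ s, x < rank o) (ht : ∀ x ∈ t, x < rank o')
    (h : adjoin o s = adjoin o' t) : o = o' := by
  by_contra hne
  have h1 := (agree_adjoin_iff_of_ne hne hs ht (γ := 0)).1 (h ▸ Agree.refl _ _)
  cases o with
  | none =>
    cases o' with
    | none => exact hne rfl
    | some j => exact not_lt_zero (h1 j (Or.inr rfl))
  | some i => exact not_lt_zero (h1 i (Or.inl rfl))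

theorem exists_adjoin_eq (hs : ∀ x ∈ s, x < α) :
    ∃ (o : Option α.ToType) (t : Finset Ordinal.{u}), (∀ x ∈ t, x < rank o) ∧ adjoin o t = s := by
  rcases s.eq_empty_or_nonempty with rfl | hne
  · exact ⟨none, ∅, by simp, rfl⟩
  · have hm := s.max'_mem hne
    have hi : ((Ordinal.ToType.mk ⟨_, hs _ hm⟩ : α.ToType).toOrd : Ordinal.{u}) = s.max' hne := by
      simp
    refine ⟨some (Ordinal.ToType.mk ⟨_, hs _ hm⟩), s.erase (s.max' hne), fun x hx => ?_, ?_⟩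
    · exact (s.lt_max'_of_mem_erase_max' hne hx).trans_eq hi.symm
    · exact (congrArg (insert · _) hi).trans (Finset.insert_erase hm)

end adjoin

namespace Chart

variable {V : Type u} {Γ : SimpleGraph V} {W : Option α.ToType → Type u}
  {G : ∀ o, SimpleGraph (W o)}

/-- The chart of a direct sum, obtained by adjoining the index of the summand to the labels. -/
def sum (C : ∀ o, Chart Γ (G o) (rank o)) : Chart Γ (directSum G) α where
  label w := adjoin w.1 ((C w.1).label w.2)
  point w := (C w.1).point w.2
  label_lt w := adjoin_lt ((C w.1).label_lt w.2)
  inj := by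
    rintro ⟨o, a⟩ ⟨o', b⟩ h h'
    obtain rfl := eq_of_adjoin_eq ((C o).label_lt a) ((C o').label_lt b) h
    have h1 := (agree_adjoin_iff ((C o).label_lt a) ((C o).label_lt b) (γ := 0)).1
      (h ▸ Agree.refl _ _)
    rw [(C o).inj h1.eq h']
  surj s hs v := by
    obtain ⟨o, t, ht, rfl⟩ := exists_adjoin_eq hs
    obtain ⟨w, rfl, hv⟩ := (C o).surj t ht v
    exact ⟨⟨o, w⟩, rfl, hv⟩
  adj_iff := by
    rintro ⟨o, a⟩ ⟨o', b⟩
    constructor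
    · intro h
      obtain rfl : o = o' := directSum_adj_fst G h
      have h1 := (C o).adj_iff.1 ((directSum_adj_mk G).1 h)
      exact ⟨congrArg (adjoin o) h1.1, h1.2⟩
    · rintro ⟨h, h'⟩
      obtain rfl := eq_of_adjoin_eq ((C o).label_lt a) ((C o').label_lt b) h
      have h1 := (agree_adjoin_iff ((C o).label_lt a) ((C o).label_lt b) (γ := 0)).1
        (h ▸ Agree.refl _ _)
      exact (directSum_adj_mk G).2 ((C o).adj_iff.2 ⟨h1.eq, h'⟩)

theorem agree_sum_mk (C : ∀ o, Chart Γ (G o) (rank o)) {γ : Ordinal.{u}} {o : Option α.ToType}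
    {a b : W o} : Agree γ ((sum C).label ⟨o, a⟩) ((sum C).label ⟨o, b⟩) ↔
      Agree γ ((C o).label a) ((C o).label b) :=
  agree_adjoin_iff ((C o).label_lt a) ((C o).label_lt b)

theorem agree_sum_of_ne (C : ∀ o, Chart Γ (G o) (rank o)) {γ : Ordinal.{u}} {v w : Σ o, W o}
    (h : v.1 ≠ w.1) : Agree γ ((sum C).label v) ((sum C).label w) ↔
      ∀ i, (v.1 = some i ∨ w.1 = some i) → (i.toOrd : Ordinal.{u}) < γ :=
  agree_adjoin_iff_of_ne h ((C v.1).label_lt v.2) ((C w.1).label_lt w.2)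

theorem label_sum_eq_empty_iff (C : ∀ o, Chart Γ (G o) (rank o)) {v : Σ o, W o} :
    (sum C).label v = ∅ ↔ v.1 = none := by
  obtain ⟨o, a⟩ := v
  cases o with
  | none => exact iff_of_true (eq_empty_of_lt_zero ((C none).label_lt a)) rfl
  | some i => exact iff_of_false (Finset.insert_ne_empty _ _) (by simp)

/-- The index of a factor can be read off from agreement with the empty label, which φ fixes. -/
theorem fst_apply_of_mem_isom (hΓ : Γ.Connected) (C : ∀ o, Chart Γ (G o) (rank o))
    {φ : Aut (directSum G)} (hφ : φ ∈ (sum C).isom 0) (v : Σ o, W o) : (φ v).1 = v.1 := by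
  obtain ⟨x, hx⟩ := (sum C).exists_label_empty hΓ
  have h0 : ∀ x, x.1 = none → (φ x).1 = none := fun x hx => by
    have hx := (label_sum_eq_empty_iff C).2 hx
    rw [← label_sum_eq_empty_iff C, ← (hφ.2 x hx).eq, hx]
  have hx := (label_sum_eq_empty_iff C).1 hx
  by_cases hv : v.1 = none
  · rw [h0 v hv, hv]
  have hv' : (φ v).1 ≠ none := fun h => hv <| by
    have h1 : Agree 0 ((sum C).label (φ x)) ((sum C).label (φ v)) := by
      rw [(label_sum_eq_empty_iff C).2 h, (label_sum_eq_empty_iff C).2 (h0 x hx)]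
      exact Agree.refl _ _
    rw [← label_sum_eq_empty_iff C, ← ((hφ.1 x v 0).2 h1).eq, (label_sum_eq_empty_iff C).2 hx]
  -- Compare with `x`: since `x` and `φ x` both have empty label, agreement with them from γ on says
  -- that the index is below γ.
  have key : ∀ γ, (∀ i, v.1 = some i → (i.toOrd : Ordinal.{u}) < γ) ↔
      ∀ i, (φ v).1 = some i → (i.toOrd : Ordinal.{u}) < γ := fun γ => by
    have := hφ.1 x v γ
    rw [agree_sum_of_ne C (by rw [hx]; exact Ne.symm hv),
      agree_sum_of_ne C (by rw [h0 x hx]; exact Ne.symm hv'), hx, h0 x hx] at this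
    simpa using this
  obtain ⟨i, hi⟩ := Option.ne_none_iff_exists'.1 hv
  obtain ⟨j, hj⟩ := Option.ne_none_iff_exists'.1 hv'
  have key' : ∀ γ, (i.toOrd : Ordinal.{u}) < γ ↔ (j.toOrd : Ordinal.{u}) < γ := fun γ => by
    simpa [hi, hj] using key γ
  have hij : (i.toOrd : Ordinal.{u}) = j.toOrd :=
    eq_of_forall_gt_iff key'
  rw [hi, hj, (Ordinal.ToType.mk.symm.injective (Subtype.ext hij) : i = j)]

theorem sumAut_mem_isom (C : ∀ o, Chart Γ (G o) (rank o)) {f : ∀ o, Aut (G o)}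
    (hf : ∀ o, f o ∈ (C o).isom (rank o)) : sumAut G f ∈ (sum C).isom 0 := by
  refine ⟨?_, fun v hv => ?_⟩
  · rintro ⟨o, a⟩ ⟨o', b⟩ γ
    rw [sumAut_apply, sumAut_apply]
    by_cases h : o = o'
    · subst h
      rw [agree_sum_mk, agree_sum_mk]
      exact (hf o).1 a b γ
    · rw [agree_sum_of_ne C h, agree_sum_of_ne C h]
  · have h1 : (sum C).label (sumAut G f v) = ∅ :=
      (label_sum_eq_empty_iff C).2 ((label_sum_eq_empty_iff C (v := v)).1 hv)
    rw [hv, h1]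
    exact Agree.refl _ _

theorem mem_isom_of_sumAut_mem (C : ∀ o, Chart Γ (G o) (rank o)) {f : ∀ o, Aut (G o)}
    (hf : sumAut G f ∈ (sum C).isom 0) (o : Option α.ToType) : f o ∈ (C o).isom (rank o) :=
  mem_isom_self.2 fun a b γ => by
    have := hf.1 ⟨o, a⟩ ⟨o, b⟩ γ
    rwa [sumAut_apply, sumAut_apply, agree_sum_mk, agree_sum_mk] at this

end Chart

theorem PermGraph.prod_group_eq_isom {V : Type u} {Γ : SimpleGraph V} (hΓ : Γ.Connected)
    {P : Option α.ToType → PermGraph.{u}} (C : ∀ o, Chart Γ (P o).graph (rank o))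
    (hC : ∀ o, (P o).group = (C o).isom (rank o)) :
    (PermGraph.prod P).group = (Chart.sum C).isom 0 := by
  refine SetLike.ext fun φ => PermGraph.mem_prod_group.trans ⟨?_, fun hφ => ?_⟩
  · rintro ⟨f, hf, rfl⟩
    exact Chart.sumAut_mem_isom C fun o => hC o ▸ hf o
  · obtain ⟨f, rfl⟩ := exists_eq_sumAut φ (Chart.fst_apply_of_mem_isom hΓ C hφ)
    exact ⟨f, fun o => hC o ▸ Chart.mem_isom_of_sumAut_mem C hφ o, rfl⟩

/-! ### Induction on the stage -/

theorem exists_chart_stageH {V : Type u} {Γ : SimpleGraph V} (hΓ : Γ.Connected)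
    (α : Ordinal.{u}) :
    ∃ C : Chart Γ (stageH Γ α).graph α, (stageH Γ α).group = C.isom 0 := by
  induction α using WellFoundedLT.induction with
  | _ α ih =>
  rcases eq_or_ne α 0 with rfl | hα
  · rw [stageH_zero]
    exact ⟨Chart.single Γ, (Chart.isom_single Γ 0).symm⟩
  · rw [stageH_of_ne_zero Γ hα]
    have hF : ∀ o : Option α.ToType, ∃ C : Chart Γ
        (o.elim (stageF Γ 0) fun i => stageF Γ (i.toOrd : Ordinal.{u})).graph (rank o),
        (o.elim (stageF Γ 0) fun i => stageF Γ (i.toOrd : Ordinal.{u})).group =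
          C.isom (rank o) := by
      have hF' : ∀ β < α, ∃ C : Chart Γ (stageF Γ β).graph β, (stageF Γ β).group = C.isom β := by
        intro β hβ
        obtain ⟨C, hC⟩ := ih β hβ
        exact ⟨C, (congrArg terminal hC).trans (C.terminal_isom hΓ)⟩
      rintro (_ | i)
      · exact hF' 0 (pos_iff_ne_zero.2 hα)
      · exact hF' _ i.toOrd.2
    choose C hC using hF
    exact ⟨Chart.sum C, PermGraph.prod_group_eq_isom hΓ C hC⟩

end NormaliserTower
end

theorem mainTheorem6 {V : Type u} (Γ : SimpleGraph V) (hconn : Γ.Connected)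
    (hrigid : NormaliserTower.IsRigid Γ) (α : Ordinal.{u}) :
    NormaliserTower.TerminatesInExactly (NormaliserTower.stageH Γ α).group α := by
  obtain ⟨C, hC⟩ := NormaliserTower.exists_chart_stageH hconn α
  rw [hC]
  exact C.terminatesInExactly hconn
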